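/- A Moufang loop is a set with a multiplication, a neutral element $e$ and unique left and right division, satisfying $xy\cdot zx = x(yz\cdot x)$ for all $x,y,z$. For a group $G$ of finite order $n$, Chein's loop $M_{2n}(G,2)$ is the set of formal elements $gu^{\alpha}$ ($g\in G$, $\alpha\in\{0,1\}$) with multiplication $$gu^{\alpha}\cdot hu^{\beta}=\bigl(g^{(-1)^{\beta}}h^{(-1)^{\alpha+\beta}}\bigr)^{(-1)^{\beta}}u^{\alpha+\beta},$$ where the exponent $\alpha+\beta$ of $u$ is taken modulo $2$; $G$ is identified with the elements $gu^0$, and $u$ is the element $eu^1$. **Theorem.** Let $G=\langle x,y;R\rangle$ be a presentation, in the variety of groups, of a finite group $G$ of order $n$, where $R$ is a set of relations $v=w$ between bracketed words $v,w$ in $x,y$ (formed with $e$, the multiplication and the divisions $a\backslash b$, $a/b$, which in groups are $a^{-1}b$, $ab^{-1}$; the inverse $a^{-1}$ is written $a\backslash e$). Then, in the variety of Moufang loops, $M_{2n}(G,2)$ is presented by $$\langle x,y,u;\ R,\ u^2=(xu)^2=(yu)^2=(xy\cdot u)^2=e\rangle .$$ That is, the Moufang loop freely generated by $x,y,u$ subject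 to these relations is isomorphic to $M_{2n}(G,2)$ by an isomorphism that sends the generators $x,y,u$ to the elements $x,y\in G$ and $u$ of $M_{2n}(G,2)$. -/

import Mathlib

/-- Moufang loops, as a variety with operations `·`, `1`, left division `ldiv a b = a \ b` and
right division `rdiv b a = b / a`: loops satisfying the Moufang identity `xy·zx = x(yz·x)`. -/
class MoufangLoop (L : Type*) extends MulOneClass L where
  ldiv : L → L → L
  rdiv : L → L → L
  mul_ldiv : ∀ a b : L, a * ldiv a b = b
  ldiv_mul : ∀ a b : L, ldiv a (a * b) = b
  rdiv_mul : ∀ a b : L, rdiv b a * a = b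
  mul_rdiv : ∀ a b : L, rdiv (b * a) a = b
  moufang : ∀ x y z : L, (x * y) * (z * x) = x * ((y * z) * x)

/-- Words (terms) in the language of loops, on a set `α` of generators. Words are bracketed.
The inverse of a word `w` is written `ldiv w one`. -/
inductive LoopWord (α : Type) : Type
  | var : α → LoopWord α
  | one : LoopWord α
  | mul : LoopWord α → LoopWord α → LoopWord α
  | ldiv : LoopWord α → LoopWord α → LoopWord α
  | rdiv : LoopWord α → LoopWord α → LoopWord α

namespace LoopWord

/-- Rename the generators of a word. -/
def map {α β : Type} (f : α → β) : LoopWord α → LoopWord β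
  | var a => var (f a)
  | one => one
  | mul v w => mul (map f v) (map f w)
  | ldiv v w => ldiv (map f v) (map f w)
  | rdiv v w => rdiv (map f v) (map f w)

/-- The square of a word. -/
def sq {α : Type} (w : LoopWord α) : LoopWord α := mul w w

/-- The element of the free group that a word represents when it is read in groups, where
`v \ w = v⁻¹ w` and `v / w = v w⁻¹`. -/
def toFreeGroup {α : Type} : LoopWord α → FreeGroup α
  | var a => FreeGroup.of a
  | one => 1
  | mul v w => toFreeGroup v * toFreeGroup w
  | ldiv v w => (toFreeGroup v)⁻¹ * toFreeGroup w
  | rdiv v w => toFreeGroup v * (toFreeGroup w)⁻¹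

end LoopWord

/-- The group `⟨α; R⟩` presented, in the variety of groups, by the relations `v = w` for
`(v, w) ∈ R`. -/
abbrev GroupPresentedBy {α : Type} (R : Set (LoopWord α × LoopWord α)) : Type :=
  PresentedGroup ((fun p : LoopWord α × LoopWord α => p.1.toFreeGroup * (p.2.toFreeGroup)⁻¹) '' R)

/-- `G = ⟨α; R⟩` as a group, the generator `a : α` being the element `v a` of `G`. -/
def IsGroupPresentation {α : Type} (R : Set (LoopWord α × LoopWord α))
    {G : Type*} [Group G] (v : α → G) : Prop :=
  ∃ φ : GroupPresentedBy R ≃* G, ∀ a : α, φ (PresentedGroup.of a) = v a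

/-- `MoufangDerivable R v w`: the equation `v = w` can be derived from the relations in `R` and
the defining identities of Moufang loops. It is the least congruence on words that contains `R`
and whose quotient is a Moufang loop. -/
inductive MoufangDerivable {α : Type} (R : Set (LoopWord α × LoopWord α)) :
    LoopWord α → LoopWord α → Prop
  | rel {v w : LoopWord α} : (v, w) ∈ R → MoufangDerivable R v w
  | refl (v : LoopWord α) : MoufangDerivable R v v
  | symm {v w : LoopWord α} : MoufangDerivable R v w → MoufangDerivable R w v
  | trans {u v w : LoopWord α} :
      MoufangDerivable R u v → MoufangDerivable R v w → MoufangDerivable R u w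
  | mul_congr {v v' w w' : LoopWord α} : MoufangDerivable R v v' → MoufangDerivable R w w' →
      MoufangDerivable R (.mul v w) (.mul v' w')
  | ldiv_congr {v v' w w' : LoopWord α} : MoufangDerivable R v v' → MoufangDerivable R w w' →
      MoufangDerivable R (.ldiv v w) (.ldiv v' w')
  | rdiv_congr {v v' w w' : LoopWord α} : MoufangDerivable R v v' → MoufangDerivable R w w' →
      MoufangDerivable R (.rdiv v w) (.rdiv v' w')
  | one_mul (a : LoopWord α) : MoufangDerivable R (.mul .one a) a
  | mul_one (a : LoopWord α) : MoufangDerivable R (.mul a .one) a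
  | mul_ldiv (a b : LoopWord α) : MoufangDerivable R (.mul a (.ldiv a b)) b
  | ldiv_mul (a b : LoopWord α) : MoufangDerivable R (.ldiv a (.mul a b)) b
  | rdiv_mul (a b : LoopWord α) : MoufangDerivable R (.mul (.rdiv b a) a) b
  | mul_rdiv (a b : LoopWord α) : MoufangDerivable R (.rdiv (.mul b a) a) b
  | moufang (x y z : LoopWord α) : MoufangDerivable R
      (.mul (.mul x y) (.mul z x)) (.mul x (.mul (.mul y z) x))

/-- The congruence of derivable equality. -/
def moufangSetoid {α : Type} (R : Set (LoopWord α × LoopWord α)) : Setoid (LoopWord α) where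
  r := MoufangDerivable R
  iseqv := ⟨.refl, .symm, .trans⟩

/-- The Moufang loop `⟨α; R⟩` presented, in the variety of Moufang loops, by the relations `v = w`
for `(v, w) ∈ R`. -/
def MoufangPresentedBy {α : Type} (R : Set (LoopWord α × LoopWord α)) : Type :=
  Quotient (moufangSetoid R)

namespace MoufangPresentedBy

variable {α : Type} {R : Set (LoopWord α × LoopWord α)}

/-- The element of the presented Moufang loop that a word represents. -/
def mk (R : Set (LoopWord α × LoopWord α)) (w : LoopWord α) : MoufangPresentedBy R :=
  Quotient.mk (moufangSetoid R) w

/-- The canonical generators of the presented Moufang loop. -/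
def of (R : Set (LoopWord α × LoopWord α)) (a : α) : MoufangPresentedBy R := mk R (.var a)

instance : MoufangLoop (MoufangPresentedBy R) where
  one := mk R .one
  mul := Quotient.map₂ .mul (fun _ _ h _ _ k => MoufangDerivable.mul_congr h k)
  ldiv := Quotient.map₂ .ldiv (fun _ _ h _ _ k => MoufangDerivable.ldiv_congr h k)
  rdiv := Quotient.map₂ .rdiv (fun _ _ h _ _ k => MoufangDerivable.rdiv_congr h k)
  one_mul := by rintro ⟨a⟩; exact Quotient.sound (.one_mul a)
  mul_one := by rintro ⟨a⟩; exact Quotient.sound (.mul_one a)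
  mul_ldiv := by rintro ⟨a⟩ ⟨b⟩; exact Quotient.sound (.mul_ldiv a b)
  ldiv_mul := by rintro ⟨a⟩ ⟨b⟩; exact Quotient.sound (.ldiv_mul a b)
  rdiv_mul := by rintro ⟨a⟩ ⟨b⟩; exact Quotient.sound (.rdiv_mul a b)
  mul_rdiv := by rintro ⟨a⟩ ⟨b⟩; exact Quotient.sound (.mul_rdiv a b)
  moufang := by rintro ⟨x⟩ ⟨y⟩ ⟨z⟩; exact Quotient.sound (.moufang x y z)

end MoufangPresentedBy

/-- `L = ⟨α; R⟩` in the variety of Moufang loops, the generator `a : α` being the element `v a`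
of `L`. (An isomorphism for the multiplication also respects `1` and both divisions.) -/
def IsMoufangPresentation {α : Type} (R : Set (LoopWord α × LoopWord α))
    {L : Type*} [MoufangLoop L] (v : α → L) : Prop :=
  ∃ φ : MoufangPresentedBy R ≃* L, ∀ a : α, φ (MoufangPresentedBy.of R a) = v a

/-- The underlying set of Chein's loop `M(G, 2)`: the formal elements `g u ^ α` with `g ∈ G` and
`α ∈ {0, 1}`, the exponent `α` being read modulo `2`. -/
@[ext]
structure CheinLoop (G : Type*) where
  elt : G
  exp : ZMod 2

namespace CheinLoop

theorem cases_exp {H : Type*} {p : CheinLoop H → Prop} (h0 : ∀ g, p ⟨g, 0⟩)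
    (h1 : ∀ g, p ⟨g, 1⟩) :
    ∀ a, p a := by
  rintro ⟨g, e⟩
  fin_cases e
  · exact h0 g
  · exact h1 g

variable {G : Type*} [Group G]

/-- Chein's multiplication
`g u^α · h u^β = (g^((-1)^β) h^((-1)^(α+β)))^((-1)^β) u^(α+β)`. -/
instance : Mul (CheinLoop G) where
  mul a b :=
    ⟨(a.elt ^ ((-1 : ℤ) ^ b.exp.val) * b.elt ^ ((-1 : ℤ) ^ (a.exp + b.exp).val)) ^
        ((-1 : ℤ) ^ b.exp.val), a.exp + b.exp⟩

/-- The embedding of `G`. -/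
def ofGroup (g : G) : CheinLoop G := ⟨g, 0⟩

/-- The new element `u`. -/
def u : CheinLoop G := ⟨1, 1⟩

instance : One (CheinLoop G) := ⟨ofGroup 1⟩

/-- Inverses: `g⁻¹` for `g ∈ G`, while `g u` is its own inverse. -/
instance : Inv (CheinLoop G) := ⟨fun a => ⟨if a.exp = 0 then a.elt⁻¹ else a.elt, a.exp⟩⟩

theorem mk_zero_mul_mk_zero (g h : G) : (⟨g, 0⟩ : CheinLoop G) * ⟨h, 0⟩ = ⟨g * h, 0⟩ := by
  change CheinLoop.mk _ _ = _
  simp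

theorem mk_one_mul_mk_zero (g h : G) : (⟨g, 1⟩ : CheinLoop G) * ⟨h, 0⟩ = ⟨g * h⁻¹, 1⟩ := by
  change CheinLoop.mk _ _ = _
  simp [ZMod.val_one]

theorem mk_zero_mul_mk_one (g h : G) : (⟨g, 0⟩ : CheinLoop G) * ⟨h, 1⟩ = ⟨h * g, 1⟩ := by
  change CheinLoop.mk _ _ = _
  simp [ZMod.val_one]

theorem mk_one_mul_mk_one (g h : G) : (⟨g, 1⟩ : CheinLoop G) * ⟨h, 1⟩ = ⟨h⁻¹ * g, 0⟩ := by
  have h2 : (1 : ZMod 2) + 1 = 0 := rfl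
  change CheinLoop.mk _ _ = _
  simp [ZMod.val_one, h2]

theorem one_def : (1 : CheinLoop G) = ⟨1, 0⟩ := rfl

theorem inv_mk_zero (g : G) : (⟨g, 0⟩ : CheinLoop G)⁻¹ = ⟨g⁻¹, 0⟩ := rfl

theorem inv_mk_one (g : G) : (⟨g, 1⟩ : CheinLoop G)⁻¹ = ⟨g, 1⟩ := rfl

instance : MoufangLoop (CheinLoop G) where
  ldiv a b := a⁻¹ * b
  rdiv b a := b * a⁻¹
  one_mul := by
    refine cases_exp ?_ ?_ <;> intro g <;>
      simp [one_def, mk_zero_mul_mk_zero, mk_zero_mul_mk_one]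
  mul_one := by
    refine cases_exp ?_ ?_ <;> intro g <;>
      simp [one_def, mk_zero_mul_mk_zero, mk_one_mul_mk_zero]
  mul_ldiv := by
    refine cases_exp ?_ ?_ <;> intro g <;> refine cases_exp ?_ ?_ <;> intro h <;>
      simp [inv_mk_zero, inv_mk_one, mk_zero_mul_mk_zero, mk_one_mul_mk_zero,
        mk_zero_mul_mk_one, mk_one_mul_mk_one]
  ldiv_mul := by
    refine cases_exp ?_ ?_ <;> intro g <;> refine cases_exp ?_ ?_ <;> intro h <;>
      simp [inv_mk_zero, inv_mk_one, mk_zero_mul_mk_zero, mk_one_mul_mk_zero,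
        mk_zero_mul_mk_one, mk_one_mul_mk_one]
  rdiv_mul := by
    refine cases_exp ?_ ?_ <;> intro g <;> refine cases_exp ?_ ?_ <;> intro h <;>
      simp [inv_mk_zero, inv_mk_one, mk_zero_mul_mk_zero, mk_one_mul_mk_zero,
        mk_zero_mul_mk_one, mk_one_mul_mk_one]
  mul_rdiv := by
    refine cases_exp ?_ ?_ <;> intro g <;> refine cases_exp ?_ ?_ <;> intro h <;>
      simp [inv_mk_zero, inv_mk_one, mk_zero_mul_mk_zero, mk_one_mul_mk_zero,
        mk_zero_mul_mk_one, mk_one_mul_mk_one]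
  moufang := by
    refine cases_exp ?_ ?_ <;> intro g <;> refine cases_exp ?_ ?_ <;> intro h <;>
      refine cases_exp ?_ ?_ <;> intro k <;>
      simp [mk_zero_mul_mk_zero, mk_one_mul_mk_zero,
        mk_zero_mul_mk_one, mk_one_mul_mk_one, mul_assoc]

end CheinLoop

/-- The relations `R, u² = (xu)² = (yu)² = (xy·u)² = e` in the generators `x = 0`, `y = 1`,
`u = 2`, where `R` is a set of relations in the generators `x = 0`, `y = 1`. -/
def cheinRelations (R : Set (LoopWord (Fin 2) × LoopWord (Fin 2))) :
    Set (LoopWord (Fin 3) × LoopWord (Fin 3)) :=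
  let x : LoopWord (Fin 3) := .var 0
  let y : LoopWord (Fin 3) := .var 1
  let u : LoopWord (Fin 3) := .var 2
  Prod.map (LoopWord.map Fin.castSucc) (LoopWord.map Fin.castSucc) '' R ∪
    {(u.sq, .one), ((x.mul u).sq, .one), ((y.mul u).sq, .one), (((x.mul y).mul u).sq, .one)}

/-!
In a Moufang loop, a triple that associates keeps doing so when its entries are permuted, inverted,
or multiplied into one another. So if `x`, `y`, `z` associate, then the translates of `z` by left
multiplications by `x` and `y` still associate with them, and from this the map `w ↦ w • 1` of the
free group acting by left translations is a homomorphism: `x` and `y` generate a group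
(diassociativity). In the presented loop this homomorphism respects `R`, so it factors through a
homomorphism `f` on `G`.

The relations on `u` say that `u` is an involution whose conjugation inverts `1`, `x`, `y` and
`xy`. Since `L_{a(ba)} = L_a L_b L_a` for the left translations, the set of `g ∈ G` with
`u · f g u = (f g)⁻¹` is closed under `(a, b) ↦ a b⁻¹ a`, and a subset of a group with these
properties contains the subgroup generated by `x` and `y`, that is, all of `G`. Once `u` inverts
every `f g`, the Moufang identities evaluate the products of elements `f g` and `f g · u` by
Chein's formula, which yields the inverse of the canonical map onto `CheinLoop G`.
-/

/-- A subset of a group that contains `1`, `x`, `y` and `x * y` and is closed under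
`(a, b) ↦ a * b⁻¹ * a`. Such a set contains the subgroup generated by `x` and `y`, which reduces
a claim about that subgroup to four instances and one closure property. -/
structure IsTwistedSubset {H : Type*} [Group H] (x y : H) (S : Set H) : Prop where
  one_mem : 1 ∈ S
  left_mem : x ∈ S
  right_mem : y ∈ S
  mul_mem : x * y ∈ S
  twist_mem {a b : H} : a ∈ S → b ∈ S → a * b⁻¹ * a ∈ S

namespace IsTwistedSubset

variable {H : Type*} [Group H] {x y : H} {S : Set H}

theorem inv_mem (hS : IsTwistedSubset x y S) {a : H} (ha : a ∈ S) : a⁻¹ ∈ S := by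
  simpa using hS.twist_mem hS.one_mem ha

theorem mul_mul_mem (hS : IsTwistedSubset x y S) {a b : H} (ha : a ∈ S) (hb : b ∈ S) :
    a * b * a ∈ S := by
  simpa using hS.twist_mem ha (hS.inv_mem hb)

theorem inv_mul_mem (hS : IsTwistedSubset x y S) : x⁻¹ * y ∈ S := by
  have h : y * (x * y)⁻¹ * y ∈ S := hS.twist_mem hS.right_mem hS.mul_mem
  simpa [mul_assoc] using h

theorem inv_left (hS : IsTwistedSubset x y S) : IsTwistedSubset x⁻¹ y S where
  __ := hS
  left_mem := hS.inv_mem hS.left_mem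
  mul_mem := hS.inv_mul_mem

theorem swap (hS : IsTwistedSubset x y S) : IsTwistedSubset y x S where
  __ := hS
  left_mem := hS.right_mem
  right_mem := hS.left_mem
  mul_mem := by
    have h : x * (x⁻¹ * y) * x ∈ S := hS.mul_mul_mem hS.left_mem hS.inv_mul_mem
    simpa using h

theorem preimage_mul_left_gen (hS : IsTwistedSubset x y S) :
    IsTwistedSubset x y ((· * x) ⁻¹' S) where
  one_mem := by simpa using hS.left_mem
  left_mem := by simpa using hS.mul_mul_mem hS.left_mem hS.one_mem
  right_mem := hS.swap.mul_mem
  mul_mem := hS.mul_mul_mem hS.left_mem hS.right_mem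
  twist_mem {a b} ha hb := by
    have h : a * x * (b * x)⁻¹ * (a * x) ∈ S := hS.twist_mem ha hb
    simpa [mul_assoc] using h

theorem preimage_mul_left_gen_inv (hS : IsTwistedSubset x y S) :
    IsTwistedSubset x y ((· * x⁻¹) ⁻¹' S) := by
  simpa using hS.inv_left.preimage_mul_left_gen.inv_left

theorem closure_pair_subset (hS : IsTwistedSubset x y S) :
    (Subgroup.closure {x, y} : Set H) ⊆ S := by
  intro g hg
  induction hg using Subgroup.closure_induction_right generalizing S with
  | one => exact hS.one_mem
  | mul_right a _ c hc ih =>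
    rcases hc with rfl | rfl
    · exact ih hS.preimage_mul_left_gen
    · exact ih hS.swap.preimage_mul_left_gen.swap
  | mul_inv_cancel a _ c hc ih =>
    rcases hc with rfl | rfl
    · exact ih hS.preimage_mul_left_gen_inv
    · exact ih hS.swap.preimage_mul_left_gen_inv.swap

end IsTwistedSubset

namespace MoufangLoop

variable {L : Type*} [MoufangLoop L]

instance : IsCancelMul L where
  mul_left_cancel a b c (h : a * b = a * c) := by rw [← ldiv_mul a b, h, ldiv_mul]
  mul_right_cancel a b c (h : b * a = c * a) := by rw [← mul_rdiv a b, h, mul_rdiv]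

theorem eq_ldiv_of_mul_eq {a b c : L} (h : a * b = c) : b = ldiv a c := by
  rw [← h, ldiv_mul]

theorem eq_rdiv_of_mul_eq {a b c : L} (h : b * a = c) : b = rdiv c a := by
  rw [← h, mul_rdiv]

/-- The inverse `a \ 1`. It is scoped because `CheinLoop` carries another instance of `Inv`, which
agrees with this one only propositionally. -/
scoped instance instInv : Inv L := ⟨fun a => ldiv a 1⟩

theorem mul_inv_cancel (a : L) : a * a⁻¹ = 1 := mul_ldiv a 1

theorem eq_inv_of_mul_eq_one {a b : L} (h : a * b = 1) : b = a⁻¹ := eq_ldiv_of_mul_eq h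

theorem flexible (x y : L) : x * y * x = x * (y * x) := by
  simpa using moufang x y 1

theorem mul_inv_cancel_left (a b : L) : a * (a⁻¹ * b) = b := by
  have h := moufang a a⁻¹ b
  rw [mul_inv_cancel, one_mul, ← flexible] at h
  exact (mul_right_cancel h).symm

theorem inv_mul_cancel (a : L) : a⁻¹ * a = 1 :=
  mul_left_cancel (a := a) (by rw [mul_inv_cancel_left, mul_one])

/-- Scoped for the same reason as `MoufangLoop.instInv`. -/
scoped instance instInvolutiveInv : InvolutiveInv L where
  inv_inv a := (eq_inv_of_mul_eq_one (inv_mul_cancel a)).symm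

theorem inv_mul_cancel_left (a b : L) : a⁻¹ * (a * b) = b := by
  simpa using mul_inv_cancel_left a⁻¹ b

theorem inv_mul_cancel_right (a b : L) : a * b⁻¹ * b = a := by
  have h := moufang b a b⁻¹
  rw [inv_mul_cancel, mul_one] at h
  exact (mul_left_cancel h).symm

theorem mul_inv_cancel_right (a b : L) : a * b * b⁻¹ = a := by
  simpa using inv_mul_cancel_right a b⁻¹

theorem mul_inv_rev (a b : L) : (a * b)⁻¹ = b⁻¹ * a⁻¹ := by
  have h : (a * b)⁻¹ * a = b⁻¹ := by
    simpa only [mul_inv_cancel_right] using inv_mul_cancel_left (a * b) b⁻¹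
  rw [← h, mul_inv_cancel_right]

theorem left_moufang (x y z : L) : x * (y * x) * z = x * (y * (x * z)) := by
  have h := moufang x (y * (x * z)) (x * z)⁻¹
  rw [mul_inv_cancel_right, mul_inv_rev, inv_mul_cancel_right] at h
  rw [← h, inv_mul_cancel_right]

theorem right_moufang (x y z : L) : z * (x * (y * x)) = z * x * y * x := by
  rw [← inv_inj, ← flexible]
  simpa only [mul_inv_rev, mul_assoc] using left_moufang x⁻¹ y⁻¹ z⁻¹

theorem left_alternative (x z : L) : x * x * z = x * (x * z) := by
  simpa using left_moufang x 1 z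

section Associating

/-- The triple `x`, `y`, `z`, in this order, associates. -/
def Associates (x y z : L) : Prop := x * y * z = x * (y * z)

variable {x y z : L}

theorem associates_iff_rotate : Associates x y z ↔ Associates y z x⁻¹ := by
  have h : x * y * z = x * (y * (z * x⁻¹) * x) := by
    simpa only [inv_mul_cancel_right] using moufang x y (z * x⁻¹)
  calc x * y * z = x * (y * z)
    _ ↔ y * (z * x⁻¹) * x = y * z := by rw [h, mul_right_inj]
    _ ↔ y * (z * x⁻¹) = y * z * x⁻¹ := by
      rw [← mul_left_inj x⁻¹, mul_inv_cancel_right]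
    _ ↔ y * z * x⁻¹ = y * (z * x⁻¹) := eq_comm

theorem associates_iff_shift : Associates x y z ↔ Associates (y * x⁻¹) x z := by
  have h : y * x⁻¹ * (x * z) = x⁻¹ * (x * y * z) := by
    simpa only [← flexible, inv_mul_cancel_left] using left_moufang x⁻¹ (x * y) (x * z)
  calc x * y * z = x * (y * z)
    _ ↔ x⁻¹ * (x * y * z) = y * z := by rw [← mul_right_inj x⁻¹, inv_mul_cancel_left]
    _ ↔ y * z = y * x⁻¹ * (x * z) := by rw [h, eq_comm]
    _ ↔ y * x⁻¹ * x * z = y * x⁻¹ * (x * z) := by rw [inv_mul_cancel_right]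

namespace Associates

theorem rotate₃ (h : Associates x y z) : Associates x⁻¹ y⁻¹ z⁻¹ :=
  associates_iff_rotate.1 (associates_iff_rotate.1 (associates_iff_rotate.1 h))

theorem reverse (h : Associates x y z) : Associates z y x := by
  have h' : (x⁻¹ * y⁻¹ * z⁻¹)⁻¹ = (x⁻¹ * (y⁻¹ * z⁻¹))⁻¹ := congrArg (·⁻¹) h.rotate₃
  simp only [mul_inv_rev, inv_inv] at h'
  exact h'.symm

theorem inv_mul_mul_inv (h : Associates x y z) : Associates x⁻¹ y (z * x⁻¹) := by
  have h' : y * z * x⁻¹ = y * (z * x⁻¹) := associates_iff_rotate.1 h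
  refine associates_iff_rotate.2 ?_
  rw [Associates, inv_inv, inv_mul_cancel_right, ← h', inv_mul_cancel_right]

theorem inv_mid_mul (h : Associates x y z) : Associates x y⁻¹ (z * x) := by
  have h' : Associates (z * x) x⁻¹ y := by
    simpa using associates_iff_shift.1 (associates_iff_rotate.1 h).reverse
  simpa using associates_iff_rotate.1 h'.rotate₃

theorem inv_right (h : Associates x y z) : Associates x y z⁻¹ := by
  have h' : Associates x⁻¹ y⁻¹ z := by
    simpa only [mul_inv_cancel_right] using h.inv_mid_mul.inv_mul_mul_inv
  simpa only [inv_inv] using h'.rotate₃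

theorem rotate (h : Associates x y z) : Associates y z x := by
  simpa only [inv_inv] using (associates_iff_rotate.1 h).inv_right

theorem swap (h : Associates x y z) : Associates y x z := h.reverse.rotate

theorem inv_left (h : Associates x y z) : Associates x⁻¹ y z := h.rotate.inv_right.rotate.rotate

theorem mul_left (h : Associates x y z) : Associates x y (x * z) := by
  simpa only [mul_inv_rev, inv_inv] using h.inv_right.inv_mul_mul_inv.inv_left.inv_right

theorem inv_mul_left (h : Associates x y z) : Associates x y (x⁻¹ * z) := by
  simpa only [inv_inv] using h.inv_left.mul_left.inv_left

end Associates

end Associating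

/-- Left translation, as a permutation. -/
@[simps]
def leftMul (a : L) : Equiv.Perm L where
  toFun z := a * z
  invFun z := a⁻¹ * z
  left_inv := inv_mul_cancel_left a
  right_inv := mul_inv_cancel_left a

theorem leftMul_injective : Function.Injective (leftMul : L → Equiv.Perm L) := fun a b h => by
  simpa using DFunLike.congr_fun h 1

theorem leftMul_inv (a : L) : leftMul a⁻¹ = (leftMul a)⁻¹ := Equiv.ext fun _ => rfl

theorem leftMul_mul_mul (x y : L) :
    leftMul (x * (y * x)) = leftMul x * leftMul y * leftMul x :=
  Equiv.ext (left_moufang x y)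

/-- The free group acting on a loop, each generator `i` by left translation by `v i`. -/
def leftAction {α : Type*} (v : α → L) : FreeGroup α →* Equiv.Perm L :=
  FreeGroup.lift (leftMul ∘ v)

theorem leftAction_of {α : Type*} (v : α → L) (i : α) :
    leftAction v (FreeGroup.of i) = leftMul (v i) :=
  FreeGroup.lift_apply_of

theorem Associates.leftAction {v : Fin 2 → L} {z : L} (h : Associates (v 0) (v 1) z)
    (w : FreeGroup (Fin 2)) : Associates (v 0) (v 1) (leftAction v w z) := by
  induction w using FreeGroup.induction_on generalizing z with
  | C1 => simpa using h
  | of i =>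
    rw [leftAction_of]
    fin_cases i
    · exact h.mul_left
    · exact h.swap.mul_left.swap
  | inv_of i _ =>
    rw [map_inv, leftAction_of]
    fin_cases i
    · exact h.inv_mul_left
    · exact h.swap.inv_mul_left.swap
  | mul a b ha hb =>
    rw [map_mul, Equiv.Perm.mul_apply]
    exact ha (hb h)

theorem closure_pair_of_freeGroup :
    Subgroup.closure {FreeGroup.of (0 : Fin 2), FreeGroup.of 1} = ⊤ := by
  rw [← FreeGroup.closure_range_of]
  congr 1
  ext
  simp [Fin.exists_fin_two, eq_comm]

/-- The value at `v` of an element of the free group, its reduced word being bracketed from the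
right. Diassociativity makes the bracketing immaterial when there are two generators. -/
def freeEval {α : Type*} (v : α → L) (w : FreeGroup α) : L := leftAction v w 1

theorem freeEval_one {α : Type*} (v : α → L) : freeEval v 1 = 1 := by
  simp [freeEval]

theorem freeEval_of {α : Type*} (v : α → L) (i : α) : freeEval v (FreeGroup.of i) = v i := by
  simp [freeEval, leftAction_of]

theorem freeEval_of_mul {α : Type*} (v : α → L) (i : α) (w : FreeGroup α) :
    freeEval v (FreeGroup.of i * w) = v i * freeEval v w := by
  simp [freeEval, leftAction_of]

theorem freeEval_twist_mul {α : Type*} {v : α → L} {a b : FreeGroup α}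
    (ha : ∀ w, freeEval v (a * w) = freeEval v a * freeEval v w)
    (hb : ∀ w, freeEval v (b * w) = freeEval v b * freeEval v w) (w : FreeGroup α) :
    freeEval v (a * b⁻¹ * a * w) = freeEval v (a * b⁻¹ * a) * freeEval v w := by
  have hb_inv (t) : freeEval v (b⁻¹ * t) = (freeEval v b)⁻¹ * freeEval v t := by
    rw [← inv_mul_cancel_left (freeEval v b) (freeEval v (b⁻¹ * t)), ← hb,
      _root_.mul_inv_cancel_left]
  calc freeEval v (a * b⁻¹ * a * w)
    _ = freeEval v a * ((freeEval v b)⁻¹ * (freeEval v a * freeEval v w)) := by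
      rw [mul_assoc, mul_assoc, ha, hb_inv, ha]
    _ = freeEval v a * ((freeEval v b)⁻¹ * freeEval v a) * freeEval v w :=
      (left_moufang _ _ _).symm
    _ = freeEval v (a * b⁻¹ * a) * freeEval v w := by
      rw [mul_assoc, ha, hb_inv]

theorem isTwistedSubset_freeEval_mul (v : Fin 2 → L) :
    IsTwistedSubset (FreeGroup.of 0) (FreeGroup.of 1)
      {a | ∀ w, freeEval v (a * w) = freeEval v a * freeEval v w} where
  one_mem w := by rw [freeEval_one, _root_.one_mul, one_mul]
  left_mem w := by rw [freeEval_of_mul, freeEval_of]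
  right_mem w := by rw [freeEval_of_mul, freeEval_of]
  mul_mem w := by
    have h : Associates (v 0) (v 1) (freeEval v w) :=
      Associates.leftAction (by rw [Associates, mul_one, mul_one]) w
    rw [mul_assoc, freeEval_of_mul, freeEval_of_mul, freeEval_of_mul, freeEval_of, h]
  twist_mem ha hb := freeEval_twist_mul ha hb

/-- Diassociativity, as an evaluation homomorphism: any two elements of a Moufang loop lie in the
image of a group. -/
def diassocHom (v : Fin 2 → L) : FreeGroup (Fin 2) →* L where
  toFun := freeEval v
  map_one' := freeEval_one v
  map_mul' a := (isTwistedSubset_freeEval_mul v).closure_pair_subset <| by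
    rw [closure_pair_of_freeGroup]
    trivial

theorem diassocHom_of (v : Fin 2 → L) (i : Fin 2) : diassocHom v (FreeGroup.of i) = v i :=
  freeEval_of v i

section Conjugation

variable {u : L}

theorem conj_eq_inv {g : L} (hu : u * u = 1) (hg : g * u * (g * u) = 1) : u * (g * u) = g⁻¹ := by
  have h : g * u = u * g⁻¹ := by
    rw [eq_inv_of_mul_eq_one hg, mul_inv_rev, ← eq_inv_of_mul_eq_one hu]
  rw [h, ← left_alternative, hu, one_mul]

theorem conj_eq_inv_iff {g : L} : u * (g * u) = g⁻¹ ↔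
    leftMul u * leftMul g * leftMul u = (leftMul g)⁻¹ := by
  rw [← leftMul_mul_mul, ← leftMul_inv, leftMul_injective.eq_iff]

variable {G : Type*} [Group G] {f : G →* L}

theorem map_inv (f : G →* L) (g : G) : f g⁻¹ = (f g)⁻¹ :=
  eq_inv_of_mul_eq_one (by rw [← map_mul, _root_.mul_inv_cancel, map_one])

theorem leftMul_map_twist (a b : G) :
    leftMul (f (a * b⁻¹ * a)) = leftMul (f a) * (leftMul (f b))⁻¹ * leftMul (f a) := by
  rw [mul_assoc, map_mul, map_mul, leftMul_mul_mul, map_inv, leftMul_inv]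

theorem isTwistedSubset_conj_eq_inv {x y : G} (hu : u * u = 1) (hx : f x * u * (f x * u) = 1)
    (hy : f y * u * (f y * u) = 1) (hxy : f x * f y * u * (f x * f y * u) = 1) :
    IsTwistedSubset x y {g | u * (f g * u) = (f g)⁻¹} where
  one_mem := conj_eq_inv hu (by rw [map_one, one_mul, hu])
  left_mem := conj_eq_inv hu hx
  right_mem := conj_eq_inv hu hy
  mul_mem := conj_eq_inv hu (by rwa [map_mul])
  twist_mem {a b} ha hb := by
    simp only [Set.mem_ofPred_eq, conj_eq_inv_iff] at ha hb ⊢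
    have h_group (p q r : Equiv.Perm L) :
        p * (q * r⁻¹ * q) * p = p * q * p * (p * r * p)⁻¹ * (p * q * p) := by group
    rw [leftMul_map_twist, h_group, ha, hb]
    group

theorem conj_map_eq_map_inv {x y : G} (hxy_gen : Subgroup.closure {x, y} = ⊤) (hu : u * u = 1)
    (hx : f x * u * (f x * u) = 1) (hy : f y * u * (f y * u) = 1)
    (hxy : f x * f y * u * (f x * f y * u) = 1) (g : G) : u * (f g * u) = f g⁻¹ := by
  rw [map_inv]
  refine (isTwistedSubset_conj_eq_inv hu hx hy hxy).closure_pair_subset ?_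
  rw [hxy_gen]
  trivial

end Conjugation

section DihedralRelations

variable {G : Type*} [Group G] {f : G →* L} {u : L}

theorem map_mul_gen (hu : u * u = 1) (hc : ∀ g, u * (f g * u) = f g⁻¹) (g : G) :
    f g * u = u * f g⁻¹ := by
  rw [← hc, ← left_alternative, hu, one_mul]

theorem map_mul_map_mul_gen (hu : u * u = 1) (hc : ∀ g, u * (f g * u) = f g⁻¹) (g h : G) :
    f g * (f h * u) = f (h * g) * u := by
  have h_conj : f (h * g)⁻¹ = u * (f g * (u * f h⁻¹)) := by
    rw [← left_moufang, hc, ← map_mul, _root_.mul_inv_rev]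
  rw [map_mul_gen hu hc h, map_mul_gen hu hc (h * g), h_conj, ← left_alternative, hu, one_mul]

theorem map_mul_gen_mul_map (hu : u * u = 1) (hc : ∀ g, u * (f g * u) = f g⁻¹) (g h : G) :
    f g * u * f h = f (g * h⁻¹) * u := by
  have h_conj : f g * u * f h * u = f (g * h⁻¹) := by
    rw [← right_moufang, hc, map_mul]
  have hu_inv : u⁻¹ = u := (eq_inv_of_mul_eq_one hu).symm
  rw [← mul_inv_cancel_right (f g * u * f h) u, hu_inv, h_conj]

theorem map_mul_gen_mul_map_mul_gen (hu : u * u = 1) (hc : ∀ g, u * (f g * u) = f g⁻¹)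
    (g h : G) : f g * u * (f h * u) = f (h⁻¹ * g) := by
  rw [map_mul_gen hu hc g, moufang, ← map_mul, hc, _root_.mul_inv_rev, _root_.inv_inv]

end DihedralRelations

theorem hom_eq_of_eqOn {G : Type*} [Group G] {s : Set G} (hs : Subgroup.closure s = ⊤)
    {f g : G →* L} (h : Set.EqOn f g s) : f = g := by
  refine MonoidHom.ext fun a => ?_
  have ha : a ∈ Subgroup.closure s := hs ▸ Subgroup.mem_top a
  induction ha using Subgroup.closure_induction with
  | mem a ha => exact h ha
  | one => rw [map_one, map_one]
  | mul a b _ _ iha ihb => rw [map_mul, map_mul, iha, ihb]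
  | inv a _ iha => rw [map_inv, map_inv, iha]

theorem map_inv_mul {G : Type*} [Group G] (f : G →* L) (a b : G) :
    f (a⁻¹ * b) = ldiv (f a) (f b) :=
  eq_ldiv_of_mul_eq (by rw [← map_mul, _root_.mul_inv_cancel_left])

theorem map_mul_inv {G : Type*} [Group G] (f : G →* L) (a b : G) :
    f (b * a⁻¹) = rdiv (f b) (f a) :=
  eq_rdiv_of_mul_eq (by rw [← map_mul, _root_.inv_mul_cancel_right])

variable {M : Type*} [MoufangLoop M]

theorem map_ldiv (f : L →* M) (a b : L) : f (ldiv a b) = ldiv (f a) (f b) :=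
  eq_ldiv_of_mul_eq (by rw [← map_mul, mul_ldiv])

theorem map_rdiv (f : L →* M) (a b : L) : f (rdiv b a) = rdiv (f b) (f a) :=
  eq_rdiv_of_mul_eq (by rw [← map_mul, rdiv_mul])

end MoufangLoop

namespace CheinLoop

variable {G : Type*} [Group G] {L : Type*} [MoufangLoop L]

/-- The embedding of `G`, as a homomorphism. -/
@[simps]
def ofGroupHom : G →* CheinLoop G where
  toFun := ofGroup
  map_one' := rfl
  map_mul' g h := (mk_zero_mul_mk_zero g h).symm

theorem ofGroup_mul_u (g : G) : ofGroup g * u = ⟨g, 1⟩ := by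
  rw [ofGroup, u, mk_zero_mul_mk_one, one_mul]

theorem mk_one_mul_self (g : G) : (⟨g, 1⟩ : CheinLoop G) * ⟨g, 1⟩ = 1 := by
  rw [mk_one_mul_mk_one, inv_mul_cancel, one_def]

/-- The universal property of Chein's loop: a homomorphism on `G` and an involution that inverts
its values by conjugation. -/
def lift (f : G →* L) (u : L) (hu : u * u = 1) (hc : ∀ g, u * (f g * u) = f g⁻¹) :
    CheinLoop G →* L where
  toFun a := if a.exp = 0 then f a.elt else f a.elt * u
  map_one' := by simp [one_def]
  map_mul' := by
    refine cases_exp ?_ ?_ <;> intro g <;> refine cases_exp ?_ ?_ <;> intro h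
    · simp [mk_zero_mul_mk_zero]
    · simp [mk_zero_mul_mk_one, MoufangLoop.map_mul_map_mul_gen hu hc]
    · simp [mk_one_mul_mk_zero, MoufangLoop.map_mul_gen_mul_map hu hc]
    · simp [mk_one_mul_mk_one, MoufangLoop.map_mul_gen_mul_map_mul_gen hu hc]

section

variable (f : G →* L) (u : L) (hu : u * u = 1) (hc : ∀ g, u * (f g * u) = f g⁻¹)

theorem lift_ofGroup (g : G) : lift f u hu hc (ofGroup g) = f g := by
  simp [lift, ofGroup]

theorem lift_u : lift f u hu hc CheinLoop.u = u := by
  simp [lift, CheinLoop.u]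

end

theorem hom_ext {f g : CheinLoop G →* L} (h : f.comp ofGroupHom = g.comp ofGroupHom)
    (hu : f u = g u) : f = g := by
  have h_group (a : G) : f (ofGroup a) = g (ofGroup a) := DFunLike.congr_fun h a
  refine MonoidHom.ext (cases_exp h_group fun a => ?_)
  rw [← ofGroup_mul_u, map_mul, map_mul, h_group, hu]

end CheinLoop

namespace LoopWord

variable {α : Type} {L : Type*} [MoufangLoop L]

/-- The value of a word in a Moufang loop. -/
def eval (v : α → L) : LoopWord α → L
  | var a => v a
  | one => 1
  | mul p q => eval v p * eval v q
  | ldiv p q => MoufangLoop.ldiv (eval v p) (eval v q)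
  | rdiv p q => MoufangLoop.rdiv (eval v p) (eval v q)

theorem eval_map {β : Type} (f : α → β) (v : β → L) (w : LoopWord α) :
    (w.map f).eval v = w.eval (v ∘ f) := by
  induction w with
  | var | one => rfl
  | mul p q hp hq | ldiv p q hp hq | rdiv p q hp hq => rw [LoopWord.map, eval, eval, hp, hq]

theorem eval_comp {M : Type*} [MoufangLoop M] (f : L →* M) (v : α → L) (w : LoopWord α) :
    w.eval (f ∘ v) = f (w.eval v) := by
  induction w with
  | var => rfl
  | one => exact (map_one f).symm
  | mul p q hp hq => rw [eval, eval, hp, hq, map_mul]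
  | ldiv p q hp hq => rw [eval, eval, hp, hq, MoufangLoop.map_ldiv]
  | rdiv p q hp hq => rw [eval, eval, hp, hq, MoufangLoop.map_rdiv]

theorem eval_comp_of (f : FreeGroup α →* L) (w : LoopWord α) :
    w.eval (f ∘ FreeGroup.of) = f w.toFreeGroup := by
  induction w with
  | var => rfl
  | one => exact (map_one f).symm
  | mul p q hp hq => rw [eval, toFreeGroup, hp, hq, map_mul]
  | ldiv p q hp hq => rw [eval, toFreeGroup, hp, hq, MoufangLoop.map_inv_mul]
  | rdiv p q hp hq => rw [eval, toFreeGroup, hp, hq, MoufangLoop.map_mul_inv]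

end LoopWord

/-- The elements `v a` of a Moufang loop satisfy the relations in `R`. -/
def Satisfies {α : Type} {L : Type*} [MoufangLoop L] (v : α → L)
    (R : Set (LoopWord α × LoopWord α)) : Prop :=
  ∀ p ∈ R, p.1.eval v = p.2.eval v

theorem Satisfies.eval_eq {α : Type} {L : Type*} [MoufangLoop L] {v : α → L}
    {R : Set (LoopWord α × LoopWord α)} (hv : Satisfies v R) {p q : LoopWord α}
    (h : MoufangDerivable R p q) : p.eval v = q.eval v := by
  induction h with
  | rel h => exact hv _ h
  | refl => rfl
  | symm _ ih => exact ih.symm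
  | trans _ _ ih₁ ih₂ => exact ih₁.trans ih₂
  | mul_congr _ _ ih₁ ih₂ | ldiv_congr _ _ ih₁ ih₂ | rdiv_congr _ _ ih₁ ih₂ =>
    rw [LoopWord.eval, LoopWord.eval, ih₁, ih₂]
  | one_mul => exact one_mul _
  | mul_one => exact mul_one _
  | mul_ldiv => exact MoufangLoop.mul_ldiv _ _
  | ldiv_mul => exact MoufangLoop.ldiv_mul _ _
  | rdiv_mul => exact MoufangLoop.rdiv_mul _ _
  | mul_rdiv => exact MoufangLoop.mul_rdiv _ _
  | moufang => exact MoufangLoop.moufang _ _ _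

namespace MoufangPresentedBy

variable {α : Type} {R : Set (LoopWord α × LoopWord α)} {L : Type*} [MoufangLoop L]

/-- The universal property of a presented Moufang loop. -/
def lift (v : α → L) (hv : Satisfies v R) : MoufangPresentedBy R →* L where
  toFun := Quotient.lift (LoopWord.eval v) fun _ _ => hv.eval_eq
  map_one' := rfl
  map_mul' := by
    rintro ⟨a⟩ ⟨b⟩
    rfl

theorem eval_of (w : LoopWord α) : w.eval (of R) = mk R w := by
  induction w with
  | var | one => rfl
  | mul p q hp hq | ldiv p q hp hq | rdiv p q hp hq => rw [LoopWord.eval, hp, hq]; rfl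

theorem satisfies_of (R : Set (LoopWord α × LoopWord α)) : Satisfies (of R) R := fun p hp => by
  rw [eval_of, eval_of]
  exact Quotient.sound (.rel hp)

theorem hom_ext {f g : MoufangPresentedBy R →* L} (h : ∀ a, f (of R a) = g (of R a)) : f = g := by
  refine MonoidHom.ext ?_
  rintro ⟨w⟩
  change f (mk R w) = g (mk R w)
  rw [← eval_of, ← LoopWord.eval_comp, ← LoopWord.eval_comp, funext (f := f ∘ of R) h]
  rfl

end MoufangPresentedBy

namespace IsGroupPresentation

variable {α : Type} {R : Set (LoopWord α × LoopWord α)} {G : Type*} [Group G] {v : α → G}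
  {L : Type*} [MoufangLoop L]

theorem closure_range (hG : IsGroupPresentation R v) : Subgroup.closure (Set.range v) = ⊤ := by
  obtain ⟨φ, hφ⟩ := hG
  obtain rfl : φ ∘ PresentedGroup.of = v := funext hφ
  have h_range : Set.range (φ ∘ PresentedGroup.of) = φ.toMonoidHom '' Set.range PresentedGroup.of :=
    Set.range_comp _ _
  rw [h_range, ← MonoidHom.map_closure, PresentedGroup.closure_range_of,
    Subgroup.map_top_of_surjective φ.toMonoidHom φ.surjective]

theorem satisfies_comp (hG : IsGroupPresentation R v) (f : G →* L) : Satisfies (f ∘ v) R := by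
  obtain ⟨φ, hφ⟩ := hG
  obtain rfl : φ ∘ PresentedGroup.of = v := funext hφ
  intro p hp
  have h_eq : (PresentedGroup.mk _ p.1.toFreeGroup : GroupPresentedBy R) =
      PresentedGroup.mk _ p.2.toFreeGroup :=
    PresentedGroup.mk_eq_mk_of_mul_inv_mem ⟨p, hp, rfl⟩
  let F : FreeGroup α →* L := (f.comp φ.toMonoidHom).comp (PresentedGroup.mk _)
  calc p.1.eval (F ∘ FreeGroup.of)
    _ = F p.1.toFreeGroup := LoopWord.eval_comp_of F p.1
    _ = F p.2.toFreeGroup := congrArg (f ∘ φ) h_eq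
    _ = p.2.eval (F ∘ FreeGroup.of) := (LoopWord.eval_comp_of F p.2).symm

theorem exists_hom_of_freeGroup (hG : IsGroupPresentation R v) (F : FreeGroup α →* L)
    (hF : Satisfies (F ∘ FreeGroup.of) R) : ∃ f : G →* L, ∀ a, f (v a) = F (FreeGroup.of a) := by
  obtain ⟨φ, hφ⟩ := hG
  let rels := (fun p : LoopWord α × LoopWord α => p.1.toFreeGroup * p.2.toFreeGroup⁻¹) '' R
  have h_ker : Subgroup.normalClosure rels ≤ F.ker := by
    refine Subgroup.normalClosure_le_normal ?_
    rintro _ ⟨p, hp, rfl⟩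
    have h_eq : F p.1.toFreeGroup = F p.2.toFreeGroup := by
      rw [← LoopWord.eval_comp_of, ← LoopWord.eval_comp_of, hF p hp]
    change F (p.1.toFreeGroup * p.2.toFreeGroup⁻¹) = 1
    rw [map_mul, h_eq, ← map_mul, mul_inv_cancel, map_one]
  have h_con : QuotientGroup.con (Subgroup.normalClosure rels) ≤ Con.ker F := fun a b hab => by
    have h_mem : a⁻¹ * b ∈ Subgroup.normalClosure rels := QuotientGroup.leftRel_apply.1 hab
    have h_one : F (a⁻¹ * b) = 1 := h_ker h_mem
    change F a = F b
    rw [← mul_inv_cancel_left a b, map_mul, h_one, mul_one]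
  let F' : GroupPresentedBy R →* L := Con.lift _ F h_con
  refine ⟨F'.comp φ.symm.toMonoidHom, fun a => ?_⟩
  change F' (φ.symm (v a)) = F (FreeGroup.of a)
  rw [← hφ, φ.symm_apply_apply]
  rfl

theorem exists_hom {R : Set (LoopWord (Fin 2) × LoopWord (Fin 2))} {v : Fin 2 → G}
    (hG : IsGroupPresentation R v) {X : Fin 2 → L} (hX : Satisfies X R) :
    ∃ f : G →* L, ∀ i, f (v i) = X i := by
  have h_of : MoufangLoop.diassocHom X ∘ FreeGroup.of = X := funext (MoufangLoop.diassocHom_of X)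
  simpa only [MoufangLoop.diassocHom_of] using
    hG.exists_hom_of_freeGroup (MoufangLoop.diassocHom X) (by rwa [h_of])

end IsGroupPresentation

theorem satisfies_cheinRelations_iff {L : Type*} [MoufangLoop L] {v : Fin 3 → L}
    {R : Set (LoopWord (Fin 2) × LoopWord (Fin 2))} :
    Satisfies v (cheinRelations R) ↔ Satisfies (v ∘ Fin.castSucc) R ∧
      v 2 * v 2 = 1 ∧ v 0 * v 2 * (v 0 * v 2) = 1 ∧ v 1 * v 2 * (v 1 * v 2) = 1 ∧
        v 0 * v 1 * v 2 * (v 0 * v 1 * v 2) = 1 := by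
  rw [Satisfies, cheinRelations]
  simp only [Set.mem_union, or_imp, forall_and, Set.forall_mem_image]
  refine and_congr ?_ ?_
  · simp only [Prod.map_fst, Prod.map_snd, LoopWord.eval_map, Satisfies]
  · simp [LoopWord.sq, LoopWord.eval]

namespace IsGroupPresentation

variable {G : Type*} [Group G] {x y : G} {R : Set (LoopWord (Fin 2) × LoopWord (Fin 2))}

theorem satisfies_cheinRelations (hG : IsGroupPresentation R ![x, y]) :
    Satisfies ![CheinLoop.ofGroup x, CheinLoop.ofGroup y, CheinLoop.u] (cheinRelations R) := by
  refine satisfies_cheinRelations_iff.2 ⟨?_, ?_, ?_, ?_, ?_⟩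
  · convert hG.satisfies_comp CheinLoop.ofGroupHom using 1
    ext i : 1
    fin_cases i <;> rfl
  · exact CheinLoop.mk_one_mul_self 1
  · change CheinLoop.ofGroup x * CheinLoop.u * (CheinLoop.ofGroup x * CheinLoop.u) = 1
    rw [CheinLoop.ofGroup_mul_u, CheinLoop.mk_one_mul_self]
  · change CheinLoop.ofGroup y * CheinLoop.u * (CheinLoop.ofGroup y * CheinLoop.u) = 1
    rw [CheinLoop.ofGroup_mul_u, CheinLoop.mk_one_mul_self]
  · change CheinLoop.ofGroupHom x * CheinLoop.ofGroupHom y * CheinLoop.u *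
      (CheinLoop.ofGroupHom x * CheinLoop.ofGroupHom y * CheinLoop.u) = 1
    rw [← map_mul, CheinLoop.ofGroupHom_apply, CheinLoop.ofGroup_mul_u, CheinLoop.mk_one_mul_self]

theorem closure_pair (hG : IsGroupPresentation R ![x, y]) : Subgroup.closure {x, y} = ⊤ := by
  simpa only [Matrix.range_cons, Matrix.range_empty, Set.union_empty, Set.singleton_union]
    using hG.closure_range

theorem exists_cheinLoop_hom (hG : IsGroupPresentation R ![x, y])
    {L : Type*} [MoufangLoop L] {v : Fin 3 → L} (hv : Satisfies v (cheinRelations R)) :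
    ∃ ψ : CheinLoop G →* L, ψ (CheinLoop.ofGroup x) = v 0 ∧ ψ (CheinLoop.ofGroup y) = v 1 ∧
      ψ CheinLoop.u = v 2 := by
  obtain ⟨hR, hu, hxu, hyu, hxyu⟩ := satisfies_cheinRelations_iff.1 hv
  obtain ⟨f, hf⟩ := hG.exists_hom hR
  have hfx : f x = v 0 := hf 0
  have hfy : f y = v 1 := hf 1
  have hc (g : G) : v 2 * (f g * v 2) = f g⁻¹ :=
    MoufangLoop.conj_map_eq_map_inv hG.closure_pair hu (by rwa [hfx]) (by rwa [hfy])
      (by rwa [hfx, hfy]) g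
  refine ⟨CheinLoop.lift f (v 2) hu hc, ?_, ?_, CheinLoop.lift_u f _ hu hc⟩
  · rw [CheinLoop.lift_ofGroup, hfx]
  · rw [CheinLoop.lift_ofGroup, hfy]

end IsGroupPresentation

theorem theorem3p1_general {G : Type*} [Group G] (x y : G)
    (R : Set (LoopWord (Fin 2) × LoopWord (Fin 2)))
    (hG : IsGroupPresentation R ![x, y]) :
    IsMoufangPresentation (cheinRelations R)
      ![CheinLoop.ofGroup x, CheinLoop.ofGroup y, (CheinLoop.u : CheinLoop G)] := by
  let φ : MoufangPresentedBy (cheinRelations R) →* CheinLoop G :=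
    MoufangPresentedBy.lift _ hG.satisfies_cheinRelations
  obtain ⟨ψ, hψx, hψy, hψu⟩ :=
    hG.exists_cheinLoop_hom (MoufangPresentedBy.satisfies_of (cheinRelations R))
  have hψφ : ψ.comp φ = MonoidHom.id _ :=
    MoufangPresentedBy.hom_ext (Fin.forall_fin_succ.2 ⟨hψx, Fin.forall_fin_two.2 ⟨hψy, hψu⟩⟩)
  have hφψ_group : (φ.comp ψ).comp CheinLoop.ofGroupHom = CheinLoop.ofGroupHom :=
    MoufangLoop.hom_eq_of_eqOn hG.closure_pair <| by
      rintro g (rfl | rfl)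
      exacts [congrArg φ hψx, congrArg φ hψy]
  have hφψ : φ.comp ψ = MonoidHom.id _ :=
    CheinLoop.hom_ext (hφψ_group.trans (MonoidHom.id_comp _).symm) (congrArg φ hψu)
  exact ⟨φ.toMulEquiv ψ hψφ hφψ, fun _ => rfl⟩

theorem theorem3p1 {G : Type*} [Group G] [Finite G] (x y : G)
    (R : Set (LoopWord (Fin 2) × LoopWord (Fin 2)))
    (hG : IsGroupPresentation R ![x, y]) :
    IsMoufangPresentation (cheinRelations R)
      ![CheinLoop.ofGroup x, CheinLoop.ofGroup y, (CheinLoop.u : CheinLoop G)] :=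
  theorem3p1_general x y R hG
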